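/- **Model.** Blocks are created one after another with independent exponential inter-arrival times of rate $\lambda>0$. Each block is created, independently, by the attacker with probability $\alpha\in[0,\tfrac12)$ and by the honest network with probability $1-\alpha$. Block $0$ is the genesis block and $b=1,2,\dots$ denotes the $b$-th block created after it; $\mathcal T^t$ is the set of blocks created up to time $t$ (genesis included). Every other block has a predecessor, and the height of a block is its distance from the genesis block. An honest block is placed on top of the tip of the chain $\mathcal C$ of the honest network. In the generalized Vector76 attack the attacker never publishes a block to the honest network, so that $\mathcal C$ consists of the genesis block and all honest blocks; $\mathrm{height}(t)$ is the height of the tip of $\mathcal C$ at time $t$. An attack policy $\pi$ decides after each block creation, as a (measurable) function of everything observed so far, on top of which existing block the attacker mines its next block (thus continuing or restarting its secret branch), and which existing chain, if any, it reveals to the lightweight client. The client is connected to the honest network and does not relay blocks. It sees the revealed chain instead of $\mathcal C$ if the revealed chain is strictly longer than $\mathcal C$; also, if both are equally long and the newest block is honest, the client sees the revealed chain with probability $\gamma\in[0,1]$ (a transmission race, independent of everything else, whose outcome the attacker does not know in advance). In all other cases it sees $\mathcal C$. For an acceptance policy $\sigma:\mathbb N\to\mathbb N$, the client accepts a block $b$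 of height $h$ if at some time $b$ is in the chain that it sees and has there at least $\sigma(h)$ confirmations, $b$ itself included. Let $\mathcal E_{\mathrm{attacked}}(b)$ be the event that $b$ is accepted and at a later time is not in $\mathcal C$. The policy $\sigma$ is *$\varepsilon$-fractional-robust against the generalized Vector76 attack* if for every attack policy, almost surely, $$\limsup_{t\to\infty}\frac{\sum_{b\in\mathcal T^t}\Pr\left(\mathcal E_{\mathrm{attacked}}(b)\right)}{\mathrm{height}(t)}<\varepsilon .$$ **Policy.** For $k\in\mathbb N=\{0,1,\dots\}$ let (with $\binom{-1}{0}=1$) $$g(k,\alpha)=\sum_{l=0}^{\infty}\frac{1-2\alpha}{1-\alpha}\left(\frac{\alpha}{1-\alpha}\right)^{l}\left(\sum_{n=0}^{k+l}\binom{n+k-1}{n}\alpha^k(1-\alpha)^n+\sum_{n=k+l+1}^{\infty}\binom{n+k-1}{n}\alpha^{n-l}(1-\alpha)^{k+l}\right),$$ and let $\sigma^{spv}_\alpha$ be the constant policy $\min\{k\in\mathbb N: g(k,\alpha)<\varepsilon(1-\alpha)\}$. **Theorem.** Let $\lambda>0$, $0\le\alpha<\tfrac12$ and $\gamma\in[0,1]$.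 For every $\varepsilon>0$ the minimum defining $\sigma^{spv}_\alpha$ exists, and $\sigma^{spv}_\alpha$ is $\varepsilon$-fractional-robust against the generalized Vector76 attack. Moreover, for every $k\in\mathbb N$ and every attack policy, under the constant acceptance policy $\sigma\equiv k$, almost surely $$\limsup_{t\to\infty}\frac{\sum_{b\in\mathcal T^t}\Pr\left(\mathcal E_{\mathrm{attacked}}(b)\right)}{\mathrm{height}(t)}\le\frac{g(k,\alpha)}{1-\alpha}.$$ -/

import Mathlib

open MeasureTheory ProbabilityTheory Filter
open scoped ENNReal

namespace Vector76

/-! ### Block creation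

Blocks are numbered in order of creation: block `0` is the genesis block and block `n + 1` is the
`(n + 1)`-st block created after it. -/

/-- One random draw `(gap, byAttacker, raceWon)`. For the draw with index `n`: `gap` is the time
between the creation of block `n` and of block `n + 1`; `byAttacker` says whether block `n + 1` is
created by the attacker; `raceWon` is the outcome of a block transmission race against block `n`. -/
abbrev Draw : Type := ℝ × Bool × Bool

def Draw.gap (d : Draw) : ℝ := d.1

def Draw.byAttacker (d : Draw) : Bool := d.2.1

def Draw.raceWon (d : Draw) : Bool := d.2.2

/-- Exponential inter-arrival time of rate `lam`; the block belongs to the attacker with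
probability `α`; the attacker wins a transmission race with probability `γ`; all independent. -/
noncomputable def drawLaw (lam : ℝ) (α γ : unitInterval) : Measure Draw :=
  (expMeasure lam).prod ((bernoulliMeasure true false α).prod (bernoulliMeasure true false γ))

/-- The law of the whole process: independent draws, one for each `n : ℕ`. -/
noncomputable def miningLaw (lam : ℝ) (α γ : unitInterval) : Measure (ℕ → Draw) :=
  Measure.infinitePi fun _ : ℕ => drawLaw lam α γ

/-- The creation time of block `n + 1`. -/
noncomputable def creationTime (ω : ℕ → Draw) (n : ℕ) : ℝ :=
  ∑ i ∈ Finset.range (n + 1), (ω i).gap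

/-- The number of blocks, genesis excluded, created up to time `t`. The block tree at time `t` thus
consists of the blocks `0, 1, …, numBlocks ω t`. -/
noncomputable def numBlocks (ω : ℕ → Draw) (t : ℝ) : ℕ :=
  {n : ℕ | creationTime ω n ≤ t}.ncard

/-! ### Attack policies and the block tree -/

/-- The draws that are known once the blocks `0, …, n` exist. -/
def history (ω : ℕ → Draw) (n : ℕ) : Fin n → Draw := fun i => ω i

/-- A policy for the generalized Vector76 attack. When the blocks `0, …, n` exist, and as a function
of everything observed so far, the attacker chooses the block on top of which it mines its next
block, and the tip of the chain that it reveals to the lightweight client (the choice `0`, the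
genesis block, amounts to revealing nothing). The attacker never publishes a block to the honest
network. Mining on the tip of the honest chain is abandoning the attack, mining on the tip of the
secret chain is continuing it. -/
structure AttackPolicy where
  mineOn : (n : ℕ) → (Fin n → Draw) → Fin (n + 1)
  reveal : (n : ℕ) → (Fin n → Draw) → Fin (n + 1)
  measurable_mineOn : ∀ n, Measurable (mineOn n)
  measurable_reveal : ∀ n, Measurable (reveal n)

/-- The tip of the chain of the honest network when the blocks `0, …, n` exist. Honest nodes mine on
the tip of the longest chain known to them, and they are never shown a block of the attacker. -/
def honestTip (ω : ℕ → Draw) : ℕ → ℕ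
  | 0 => 0
  | n + 1 => if (ω n).byAttacker then honestTip ω n else n + 1

/-- The predecessor of a block (the genesis block is mapped to itself). -/
def parent (π : AttackPolicy) (ω : ℕ → Draw) : ℕ → ℕ
  | 0 => 0
  | n + 1 => if (ω n).byAttacker then (π.mineOn n (history ω n) : ℕ) else honestTip ω n

theorem honestTip_le (ω : ℕ → Draw) (n : ℕ) : honestTip ω n ≤ n := by
  induction n with
  | zero => simp [honestTip]
  | succ n ih =>
    rw [honestTip]
    split_ifs <;> omega

theorem parent_lt (π : AttackPolicy) (ω : ℕ → Draw) (n : ℕ) : parent π ω (n + 1) < n + 1 := by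
  rw [parent]
  split_ifs
  · exact (π.mineOn n (history ω n)).isLt
  · exact Nat.lt_succ_of_le (honestTip_le ω n)

/-- The height of a block: its distance from the genesis block in the block tree. -/
def height (π : AttackPolicy) (ω : ℕ → Draw) : ℕ → ℕ
  | 0 => 0
  | n + 1 => height π ω (parent π ω (n + 1)) + 1
termination_by b => b
decreasing_by exact parent_lt π ω n

/-- The chain from the genesis block up to the block `x`. -/
def chain (π : AttackPolicy) (ω : ℕ → Draw) (x : ℕ) : Set ℕ :=
  {b | ∃ m : ℕ, (parent π ω)^[m] x = b}

/-- The chain of the honest network when the blocks `0, …, n` exist. -/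
def honestChain (π : AttackPolicy) (ω : ℕ → Draw) (n : ℕ) : Set ℕ :=
  chain π ω (honestTip ω n)

/-! ### The lightweight client -/

/-- The block revealed to the client when the blocks `0, …, n` exist. -/
def revealedTip (π : AttackPolicy) (ω : ℕ → Draw) (n : ℕ) : ℕ := π.reveal n (history ω n)

/-- The client takes the revealed chain for the valid one if it is longer than the chain of the
honest network. If the two are equally long, it does so if the newest block is honest, so that the
revealed chain was prepared in advance and is transmitted while the honest network starts to
propagate its new block, and the attacker wins this transmission race. -/
def RevealPrevails (π : AttackPolicy) (ω : ℕ → Draw) (n : ℕ) : Prop :=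
  height π ω (honestTip ω n) < height π ω (revealedTip π ω n) ∨
    (height π ω (honestTip ω n) = height π ω (revealedTip π ω n) ∧
      0 < n ∧ honestTip ω n = n ∧ (ω n).raceWon = true)

open Classical in
/-- The tip of the chain that the client sees when the blocks `0, …, n` exist. The client is
connected to the honest network. -/
noncomputable def clientTip (π : AttackPolicy) (ω : ℕ → Draw) (n : ℕ) : ℕ :=
  if RevealPrevails π ω n then revealedTip π ω n else honestTip ω n

/-- The client, using the acceptance policy `σ`, accepts block `b` when the blocks `0, …, n` exist:
`b` is in the chain that the client sees, and there are at least `σ (height of b)` blocks on top of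
it, itself included. -/
def AcceptedAt (σ : ℕ → ℕ) (π : AttackPolicy) (ω : ℕ → Draw) (b n : ℕ) : Prop :=
  b ∈ chain π ω (clientTip π ω n) ∧
    height π ω b + σ (height π ω b) ≤ height π ω (clientTip π ω n) + 1

/-- The event that block `b` is double spent: the client accepts it, and at a later time it is not in
the chain of the honest network. -/
def attacked (σ : ℕ → ℕ) (π : AttackPolicy) (b : ℕ) : Set (ℕ → Draw) :=
  {ω | ∃ n s : ℕ, n < s ∧ AcceptedAt σ π ω b n ∧ b ∉ honestChain π ω s}

/-! ### Fractional robustness -/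

/-- The sum, over all blocks created up to time `t`, of the probabilities of being double spent,
divided by the height of the chain of the honest network at time `t`. -/
noncomputable def attackedFraction (lam : ℝ) (α γ : unitInterval) (σ : ℕ → ℕ) (π : AttackPolicy)
    (ω : ℕ → Draw) (t : ℝ) : ℝ≥0∞ :=
  (∑ b ∈ Finset.range (numBlocks ω t + 1), miningLaw lam α γ (attacked σ π b)) /
    (height π ω (honestTip ω (numBlocks ω t)) : ℝ≥0∞)

/-- Robustness against a removal of an `ε` fraction of the blocks: under any attack policy the
long-run attacked fraction is almost surely less than `ε`. The limit superior is used because the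
limit need not exist for an arbitrary attack policy. -/
def IsFractionalRobust (lam : ℝ) (α γ : unitInterval) (σ : ℕ → ℕ) (ε : ℝ) : Prop :=
  ∀ π : AttackPolicy, ∀ᵐ ω ∂(miningLaw lam α γ),
    limsup (fun t : ℝ => attackedFraction lam α γ σ π ω t) atTop < ENNReal.ofReal ε

/-! ### The policy -/

/-- The geometric distribution of the pre-mined lead `l`, combined with the negative binomial
distribution of the number `n` of honest blocks in the time that the attacker needs for `k` blocks,
and with the probability of catching up. (All terms are nonnegative for `0 ≤ α < 1/2`.) -/
noncomputable def g (k : ℕ) (α : ℝ) : ℝ≥0∞ :=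
  ∑' l : ℕ, ENNReal.ofReal ((1 - 2 * α) / (1 - α) * (α / (1 - α)) ^ l) *
    ((∑ n ∈ Finset.range (k + l + 1),
        ENNReal.ofReal (((n + k - 1).choose n : ℝ) * α ^ k * (1 - α) ^ n)) +
      ∑' n : ℕ, if k + l + 1 ≤ n then
        ENNReal.ofReal (((n + k - 1).choose n : ℝ) * α ^ (n - l) * (1 - α) ^ (k + l)) else 0)

/-- The numbers of confirmations `k` with `g(k, α) < ε (1 - α)`. -/
def sufficientConfirmations (ε α : ℝ) : Set ℕ :=
  {k : ℕ | g k α < ENNReal.ofReal (ε * (1 - α))}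

/-- The policy of the lightweight client: wait, whatever the height of the block, for the least
sufficient number of confirmations. -/
noncomputable def sigmaSpv (ε α : ℝ) : ℕ → ℕ := fun _ => sInf (sufficientConfirmations ε α)

end Vector76

/-! Only attacker blocks can be double spent, since the honest chain keeps every honest block. Let L
be the walk, reflected at 0, that rises with each attacker block and falls with each honest one; no
block ever exceeds the honest height by more than L. If block `m + 1` is double spent, then,
whatever the policy, there is a time by which A attacker and H honest blocks have followed block
`m`, with k ≤ A and H ≤ L + A, L being taken at `m` (`exists_catchesUp_of_mem_attacked`). With all
ties granted to the attacker, this event depends only on the sequence of creators.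

Its probability is at most g(k, α). The lead L is stochastically dominated by the geometric
stationary law of the walk (`lintegral_leadWalk_le`). Given L, the number of honest blocks before
the k-th attacker block is negative binomial, and a deficit e that then remains is made up with the
gambler's ruin probability (α/(1-α))^e; the result is `successProb`. No stopping time is needed:
`successProb` is harmonic until success, so `attackValue`, frozen at 1 on success, is a
supermartingale that dominates the indicator of success.

Among n blocks the probabilities thus sum to at most n·g, while the honest height is asymptotic to
(1-α)n by the strong law of large numbers. A Chernoff-type bound gives g ≤ C(4α(1-α))^k with 4α(1-α)
< 1, so sufficient k exist. -/

namespace Vector76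

/-! ### Combinatorics of the block tree -/

/-- The reflected random walk that bounds the lead of the attacker. -/
def leadWalk (x : ℕ → Bool) : ℕ → ℕ
  | 0 => 0
  | n + 1 => if x n then leadWalk x n + 1 else leadWalk x n - 1

/-- The number of attacker blocks among the blocks `m + 1, …, n`. -/
def attackerCount (x : ℕ → Bool) (m n : ℕ) : ℕ := {i ∈ Finset.Ico m n | x i = true}.card

/-- The number of honest blocks among the blocks `m + 1, …, n`. -/
def honestCount (x : ℕ → Bool) (m n : ℕ) : ℕ := {i ∈ Finset.Ico m n | x i = false}.card

theorem attackerCount_self (x : ℕ → Bool) (m : ℕ) : attackerCount x m m = 0 := by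
  simp [attackerCount]

theorem honestCount_self (x : ℕ → Bool) (m : ℕ) : honestCount x m m = 0 := by
  simp [honestCount]

theorem attackerCount_succ (x : ℕ → Bool) {m n : ℕ} (h : m ≤ n) :
    attackerCount x m (n + 1) = attackerCount x m n + if x n then 1 else 0 := by
  have : Finset.Ico m (n + 1) = insert n (Finset.Ico m n) := by ext; simp; omega
  rw [attackerCount, this, Finset.filter_insert]
  split_ifs <;> simp [attackerCount]

theorem honestCount_succ (x : ℕ → Bool) {m n : ℕ} (h : m ≤ n) :
    honestCount x m (n + 1) = honestCount x m n + if x n then 0 else 1 := by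
  have : Finset.Ico m (n + 1) = insert n (Finset.Ico m n) := by ext; simp; omega
  rw [honestCount, this, Finset.filter_insert]
  cases hx : x n <;> simp [honestCount]

theorem attackerCount_mono (x : ℕ → Bool) (m : ℕ) : Monotone (attackerCount x m) := fun _ _ h =>
  Finset.card_le_card (Finset.filter_subset_filter _ (Finset.Ico_subset_Ico_right h))

theorem honestCount_add (x : ℕ → Bool) {m n : ℕ} (h : m ≤ n) :
    honestCount x 0 m + honestCount x m n = honestCount x 0 n := by
  induction n, h using Nat.le_induction with
  | base => simp [honestCount_self]
  | succ n h ih => rw [honestCount_succ x h, honestCount_succ x (Nat.zero_le n), ← ih, add_assoc]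

/-- The creators of the blocks, as a sequence of bits. -/
def attackerBits (ω : ℕ → Draw) : ℕ → Bool := fun i => (ω i).byAttacker

variable (π : AttackPolicy) (ω : ℕ → Draw)

theorem parent_succ_of_honest {n : ℕ} (h : attackerBits ω n = false) :
    parent π ω (n + 1) = honestTip ω n := by
  rw [parent, if_neg]; simpa [attackerBits] using h

theorem honestTip_succ_of_attacker {n : ℕ} (h : attackerBits ω n = true) :
    honestTip ω (n + 1) = honestTip ω n := by
  rw [honestTip]; exact if_pos h

theorem honestTip_succ_of_honest {n : ℕ} (h : attackerBits ω n = false) :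
    honestTip ω (n + 1) = n + 1 := by
  rw [honestTip, if_neg]; simpa [attackerBits] using h

theorem height_zero : height π ω 0 = 0 := by rw [height]

theorem height_succ (n : ℕ) : height π ω (n + 1) = height π ω (parent π ω (n + 1)) + 1 := by
  rw [height]

theorem height_honestTip (n : ℕ) :
    height π ω (honestTip ω n) = honestCount (attackerBits ω) 0 n := by
  induction n with
  | zero => simp [honestTip, height_zero, honestCount_self]
  | succ n ih =>
    rw [honestCount_succ _ (Nat.zero_le n)]
    cases h : attackerBits ω n
    · rw [honestTip_succ_of_honest ω h, height_succ, parent_succ_of_honest π ω h, ih]; simp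
    · rw [honestTip_succ_of_attacker ω h, ih]; simp

/-- An attacker block rises at most one above the current bound. An honest block has height exactly
the new honest count; it leaves the bound unchanged, or raises it by one when the truncated
subtraction keeps the lead at 0. -/
theorem height_le_honestCount_add_leadWalk {n b : ℕ} (hb : b ≤ n) :
    height π ω b ≤ honestCount (attackerBits ω) 0 n + leadWalk (attackerBits ω) n := by
  induction n generalizing b with
  | zero => rw [Nat.le_zero.mp hb, height_zero]; exact Nat.zero_le _
  | succ n ih =>
    rw [honestCount_succ _ (Nat.zero_le n), leadWalk]
    rcases Nat.of_le_succ hb with hb | rfl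
    · have := ih hb
      split_ifs <;> omega
    · rw [height_succ]
      cases h : attackerBits ω n
      · rw [parent_succ_of_honest π ω h, height_honestTip]
        simp
      · have := ih (Nat.lt_succ_iff.mp (parent_lt π ω n))
        simp; omega

theorem mem_chain_self (x : ℕ) : x ∈ chain π ω x := ⟨0, rfl⟩

theorem mem_chain_iff {x b : ℕ} : b ∈ chain π ω x ↔ b = x ∨ b ∈ chain π ω (parent π ω x) := by
  constructor
  · rintro ⟨_ | m, h⟩
    · exact .inl h.symm
    · exact .inr ⟨m, by simpa using h⟩
  · rintro (rfl | ⟨m, h⟩)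
    · exact mem_chain_self π ω _
    · exact ⟨m + 1, by simpa using h⟩

theorem le_of_mem_chain {x b : ℕ} (h : b ∈ chain π ω x) : b ≤ x := by
  obtain ⟨m, rfl⟩ := h
  induction m with
  | zero => exact le_rfl
  | succ m ih =>
    rw [Function.iterate_succ_apply']
    refine le_trans ?_ ih
    cases h : (parent π ω)^[m] x with
    | zero => simp [parent]
    | succ y => exact (parent_lt π ω y).le

theorem zero_mem_chain (x : ℕ) : 0 ∈ chain π ω x := by
  induction x using Nat.strong_induction_on with
  | _ x ih =>
    cases x with
    | zero => exact mem_chain_self π ω 0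
    | succ n => exact (mem_chain_iff π ω).mpr (.inr (ih _ (parent_lt π ω n)))

theorem mem_honestChain_of_honest {m s : ℕ} (hm : attackerBits ω m = false) (hs : m + 1 ≤ s) :
    m + 1 ∈ honestChain π ω s := by
  induction s, hs using Nat.le_induction with
  | base => rw [honestChain, honestTip_succ_of_honest ω hm]; exact mem_chain_self π ω _
  | succ s hs ih =>
    cases h : attackerBits ω s
    · rw [honestChain, honestTip_succ_of_honest ω h, mem_chain_iff, parent_succ_of_honest π ω h]
      exact .inr ih
    · rwa [honestChain, honestTip_succ_of_attacker ω h]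

/-- The honest tip changes only to an honest block placed on the previous honest tip. -/
theorem notMem_honestChain_of_attacker {m : ℕ} (hm : attackerBits ω m = true) (s : ℕ) :
    m + 1 ∉ honestChain π ω s := by
  induction s with
  | zero => intro h; simpa [honestTip] using le_of_mem_chain π ω h
  | succ s ih =>
    cases h : attackerBits ω s
    · rw [honestChain, honestTip_succ_of_honest ω h, mem_chain_iff, parent_succ_of_honest π ω h]
      rintro (h' | h')
      · obtain rfl : m = s := by omega
        simp [hm] at h
      · exact ih h'
    · rwa [honestChain, honestTip_succ_of_attacker ω h]

/-- No honest block can lie above an attacker block, since its predecessor is an honest tip. So each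
level of the chain from `m + 1` up to `x` uses up an attacker block; the count includes `m + 1`
itself, whence the `+ 1` on the left. -/
theorem height_lt_of_mem_chain {m : ℕ} (hm : attackerBits ω m = true) {x : ℕ}
    (hx : m + 1 ∈ chain π ω x) :
    height π ω x + 1 ≤ height π ω (m + 1) + attackerCount (attackerBits ω) m x := by
  induction x using Nat.strong_induction_on with
  | _ x ih =>
    have hle := le_of_mem_chain π ω hx
    obtain ⟨y, rfl⟩ : ∃ y, x = y + 1 := ⟨x - 1, by omega⟩
    rw [attackerCount_succ _ (by omega)]
    rcases (mem_chain_iff π ω).mp hx with h | h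
    · obtain rfl : m = y := by omega
      simp [hm]
    · cases hy : attackerBits ω y
      · rw [parent_succ_of_honest π ω hy] at h
        exact absurd h (notMem_honestChain_of_attacker π ω hm y)
      · have h1 := ih _ (parent_lt π ω y) h
        have h2 := attackerCount_mono (attackerBits ω) m (Nat.lt_succ_iff.mp (parent_lt π ω y))
        rw [height_succ π ω y]
        simp; omega

theorem clientTip_le (n : ℕ) : clientTip π ω n ≤ n := by
  rw [clientTip]
  split_ifs
  · exact Nat.lt_succ_iff.mp (π.reveal n (history ω n)).isLt
  · exact honestTip_le ω n

/-- By the time of block `n`, the attacker has mined `k` blocks after block `m`, and enough blocks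
to have caught up with the honest chain, given its maximal lead at block `m`. -/
def CatchesUp (k m : ℕ) (x : ℕ → Bool) (n : ℕ) : Prop :=
  k ≤ attackerCount x m n ∧ honestCount x m n ≤ leadWalk x m + attackerCount x m n

theorem attacked_zero (σ : ℕ → ℕ) : attacked σ π 0 = ∅ := by
  ext ω
  simp only [attacked, Set.mem_ofPred_eq, Set.mem_empty_iff_false, iff_false]
  rintro ⟨n, s, -, -, h⟩
  exact h (zero_mem_chain π ω _)

theorem exists_catchesUp_of_mem_attacked {k m : ℕ} (h : ω ∈ attacked (fun _ => k) π (m + 1)) :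
    ∃ n, m ≤ n ∧ CatchesUp k m (attackerBits ω) n := by
  obtain ⟨n, s, hns, ⟨hmem, hk⟩, hs⟩ := h
  have hmn : m + 1 ≤ n := (le_of_mem_chain π ω hmem).trans (clientTip_le π ω n)
  have hm : attackerBits ω m = true := by
    by_contra hm
    exact hs (mem_honestChain_of_honest π ω (by simpa using hm) (by omega))
  refine ⟨n, by omega, ?_⟩
  by_cases hp : RevealPrevails π ω n
  · have h1 := height_lt_of_mem_chain π ω hm hmem
    have h2 := attackerCount_mono (attackerBits ω) m (clientTip_le π ω n)
    -- A won race is a tie, so both ways of prevailing yield this weak inequality, and the race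
    -- outcomes drop out.
    have h3 : height π ω (honestTip ω n) ≤ height π ω (clientTip π ω n) := by
      rw [clientTip, if_pos hp]
      rcases hp with hp | ⟨hp, -⟩
      · exact hp.le
      · exact hp.le
    have h4 := height_le_honestCount_add_leadWalk π ω (Nat.lt_succ_iff.mp (parent_lt π ω m))
    have h5 := height_succ π ω m
    have h6 := honestCount_add (attackerBits ω) (show m ≤ n by omega)
    rw [height_honestTip] at h3
    simp only at hk
    constructor <;> omega
  · rw [clientTip, if_neg hp] at hmem
    exact absurd hmem (notMem_honestChain_of_attacker π ω hm n)

/-! ### The probability of catching up -/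

/-- The probability that a random walk with up-probability `α` ever reaches `0` from `e`, if it
starts below. -/
noncomputable def catchUpProb (α : ℝ) (e : ℤ) : ℝ≥0∞ := ENNReal.ofReal (α / (1 - α)) ^ (-e).toNat

/-- The probability that the attacker, `d` blocks ahead, mines `j` blocks and then catches up. -/
noncomputable def successProb (α : ℝ) (j : ℕ) (d : ℤ) : ℝ≥0∞ :=
  ∑' n : ℕ, ((n + j - 1).choose n : ℝ≥0∞) * ENNReal.ofReal α ^ j * ENNReal.ofReal (1 - α) ^ n *
    catchUpProb α (d + j - n)

/-- The geometric distribution of the pre-mined lead. -/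
noncomputable def leadWeight (α : ℝ) (l : ℕ) : ℝ≥0∞ :=
  ENNReal.ofReal ((1 - 2 * α) / (1 - α) * (α / (1 - α)) ^ l)

section

variable {α : ℝ}

theorem catchUpProb_of_nonneg {e : ℤ} (he : 0 ≤ e) : catchUpProb α e = 1 := by
  rw [catchUpProb, Int.toNat_of_nonpos (by omega), pow_zero]

theorem ratio_le_one (h1 : α < 1 / 2) : α / (1 - α) ≤ 1 := by
  rw [div_le_one (by linarith)]; linarith

theorem catchUpProb_mono (h1 : α < 1 / 2) : Monotone (catchUpProb α) := by
  intro d e h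
  refine pow_le_pow_of_le_one zero_le ?_ (by omega)
  exact ENNReal.ofReal_le_one.mpr (ratio_le_one h1)

theorem successProb_mono (h1 : α < 1 / 2) (j : ℕ) : Monotone (successProb α j) := by
  intro d e h
  refine ENNReal.tsum_le_tsum fun n => ?_
  gcongr
  exact catchUpProb_mono h1 (by omega)

theorem successProb_zero (d : ℤ) : successProb α 0 d = catchUpProb α d := by
  rw [successProb, tsum_eq_single 0]
  · simp
  · intro n hn
    -- For `j = 0` the coefficient `(n - 1).choose n` vanishes unless `n = 0`, where truncation
    -- gives the convention value 1.
    rw [Nat.choose_eq_zero_of_lt (by omega)]; simp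

theorem ofReal_add_ofReal_one_sub (h0 : 0 ≤ α) (h1 : α < 1 / 2) :
    ENNReal.ofReal α + ENNReal.ofReal (1 - α) = 1 := by
  rw [← ENNReal.ofReal_add h0 (by linarith)]; simp

theorem ofReal_one_sub_mul_ratio (h1 : α < 1 / 2) :
    ENNReal.ofReal (1 - α) * ENNReal.ofReal (α / (1 - α)) = ENNReal.ofReal α := by
  rw [← ENNReal.ofReal_mul (by linarith), mul_div_cancel₀ _ (by linarith)]

/-- First-step equation of gambler's ruin: r = α/(1-α) satisfies (1-α)r = α, hence αr^e +
(1-α)r^(e+2) = r^(e+1). -/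
theorem catchUpProb_step (h0 : 0 ≤ α) (h1 : α < 1 / 2) {d : ℤ} (hd : d < 0) :
    ENNReal.ofReal α * catchUpProb α (d + 1) + ENNReal.ofReal (1 - α) * catchUpProb α (d - 1) =
      catchUpProb α d := by
  obtain ⟨e, rfl⟩ : ∃ e : ℕ, d = -(e : ℤ) - 1 := ⟨(-d - 1).toNat, by omega⟩
  have e1 : (-(-(e : ℤ) - 1 + 1)).toNat = e := by omega
  have e2 : (-(-(e : ℤ) - 1)).toNat = e + 1 := by omega
  have e3 : (-(-(e : ℤ) - 1 - 1)).toNat = e + 2 := by omega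
  simp only [catchUpProb, e1, e2, e3]
  set r := ENNReal.ofReal (α / (1 - α))
  have hr : ENNReal.ofReal (1 - α) * r = ENNReal.ofReal α := ofReal_one_sub_mul_ratio h1
  calc _ = (ENNReal.ofReal (1 - α) * r) * r ^ e + (ENNReal.ofReal (1 - α) * r) * r ^ (e + 1) := by
        rw [← hr]; ring
    _ = r ^ (e + 1) * (ENNReal.ofReal α + ENNReal.ofReal (1 - α)) := by
        nth_rw 2 [hr]; ring
    _ = _ := by rw [ofReal_add_ofReal_one_sub h0 h1, mul_one]

/-- Conditioning on the creator of the next block. In the series this is Pascal's rule, once the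
terms `n = 0` have been split off. -/
theorem successProb_succ (j : ℕ) (d : ℤ) :
    ENNReal.ofReal α * successProb α j (d + 1) +
      ENNReal.ofReal (1 - α) * successProb α (j + 1) (d - 1) = successProb α (j + 1) d := by
  simp only [successProb]
  rw [tsum_eq_zero_add' (f := fun n : ℕ => ((n + j - 1).choose n : ℝ≥0∞) * ENNReal.ofReal α ^ j *
      ENNReal.ofReal (1 - α) ^ n * catchUpProb α (d + 1 + j - n)) ENNReal.summable,
    tsum_eq_zero_add' (f := fun n : ℕ => ((n + (j + 1) - 1).choose n : ℝ≥0∞) *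
      ENNReal.ofReal α ^ (j + 1) * ENNReal.ofReal (1 - α) ^ n *
        catchUpProb α (d + ((j + 1 : ℕ) : ℤ) - n)) ENNReal.summable,
    mul_add, add_assoc, ← ENNReal.tsum_mul_left, ← ENNReal.tsum_mul_left, ← ENNReal.tsum_add]
  congr 1
  · have : d + 1 + (j : ℤ) = d + ((j + 1 : ℕ) : ℤ) := by push_cast; ring
    simp [this]; ring
  · refine tsum_congr fun n => ?_
    have e1 : d + 1 + (j : ℤ) - ((n + 1 : ℕ) : ℤ) = d + j - n := by push_cast; ring
    have e2 : d - 1 + ((j + 1 : ℕ) : ℤ) - (n : ℤ) = d + j - n := by push_cast; ring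
    have e3 : d + ((j + 1 : ℕ) : ℤ) - ((n + 1 : ℕ) : ℤ) = d + j - n := by push_cast; ring
    have e4 : n + 1 + (j + 1) - 1 = (n + j) + 1 := by omega
    have e5 : n + 1 + j - 1 = n + j := by omega
    have e6 : n + (j + 1) - 1 = n + j := by omega
    rw [e1, e2, e3, e4, e5, e6, Nat.choose_succ_succ]
    push_cast
    ring

theorem one_le_successProb_zero {d : ℤ} (hd : 0 ≤ d) : 1 ≤ successProb α 0 d := by
  rw [successProb_zero, catchUpProb_of_nonneg hd]

/-- The success probability is harmonic off the set of success. -/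
theorem successProb_step (h0 : 0 ≤ α) (h1 : α < 1 / 2) {j : ℕ} {d : ℤ} (h : ¬(j = 0 ∧ 0 ≤ d)) :
    ENNReal.ofReal α * successProb α (j - 1) (d + 1) +
      ENNReal.ofReal (1 - α) * successProb α j (d - 1) = successProb α j d := by
  cases j with
  | zero =>
    simp only [successProb_zero, Nat.zero_sub]
    exact catchUpProb_step h0 h1 (by simpa using h)
  | succ j => exact successProb_succ j d

theorem g_eq_tsum_leadWeight (h0 : 0 ≤ α) (h1 : α < 1 / 2) (k : ℕ) :
    g k α = ∑' l : ℕ, leadWeight α l * successProb α k l := by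
  refine tsum_congr fun l => ?_
  rw [leadWeight]
  congr 1
  have hα : (0 : ℝ) ≤ 1 - α := by linarith
  have hfin : ∑ n ∈ Finset.range (k + l + 1),
        ENNReal.ofReal (((n + k - 1).choose n : ℝ) * α ^ k * (1 - α) ^ n) =
      ∑' n : ℕ, if k + l + 1 ≤ n then 0 else
        ENNReal.ofReal (((n + k - 1).choose n : ℝ) * α ^ k * (1 - α) ^ n) := by
    rw [tsum_eq_sum (s := Finset.range (k + l + 1))]
    · refine Finset.sum_congr rfl fun n hn => ?_
      rw [if_neg (by simpa using hn)]
    · intro n hn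
      rw [if_pos (by simpa using hn)]
  rw [hfin, ← ENNReal.tsum_add, successProb]
  refine tsum_congr fun n => ?_
  have hC : (((n + k - 1).choose n : ℕ) : ℝ≥0∞) = ENNReal.ofReal ((n + k - 1).choose n : ℝ) := by
    simp
  rw [hC, catchUpProb]
  split_ifs with hn
  · obtain ⟨e, rfl⟩ : ∃ e, n = k + l + e := ⟨n - (k + l), by omega⟩
    have e1 : (-((l : ℤ) + k - ((k + l + e : ℕ) : ℤ))).toNat = e := by push_cast; omega
    have e2 : k + l + e - l = k + e := by omega
    rw [e1, e2, zero_add, ← ENNReal.ofReal_pow h0, ← ENNReal.ofReal_pow hα,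
      ← ENNReal.ofReal_pow (by positivity), ← ENNReal.ofReal_mul (by positivity),
      ← ENNReal.ofReal_mul (by positivity), ← ENNReal.ofReal_mul (by positivity)]
    congr 1
    -- With e honest blocks in excess, catching up replaces e factors 1-α by factors α, which gives
    -- the second sum of `g`.
    have : α ^ e = (1 - α) ^ e * (α / (1 - α)) ^ e := by
      rw [← mul_pow, mul_div_cancel₀ _ (by linarith)]
    rw [pow_add α k e, this]; ring
  · rw [Int.toNat_of_nonpos (by omega), pow_zero, mul_one, add_zero, ← ENNReal.ofReal_pow h0,
      ← ENNReal.ofReal_pow hα, ← ENNReal.ofReal_mul (by positivity),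
      ← ENNReal.ofReal_mul (by positivity)]

/-! ### The stationary lead -/

/-- The transition operator of the reflected random walk. -/
noncomputable def leadStep (α : ℝ) (φ : ℕ → ℝ≥0∞) (l : ℕ) : ℝ≥0∞ :=
  ENNReal.ofReal α * φ (l + 1) + ENNReal.ofReal (1 - α) * φ (l - 1)

theorem leadStep_mono {φ : ℕ → ℝ≥0∞} (hφ : Monotone φ) : Monotone (leadStep α φ) := by
  intro l m h
  unfold leadStep
  gcongr <;> apply hφ <;> omega

/-- Detailed balance between the states `l` and `l + 1` of the reflected walk. -/
theorem leadWeight_mul (h0 : 0 ≤ α) (h1 : α < 1 / 2) (l : ℕ) :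
    leadWeight α (l + 1) * ENNReal.ofReal (1 - α) = leadWeight α l * ENNReal.ofReal α := by
  have hα : (0 : ℝ) < 1 - α := by linarith
  have h2 : (0 : ℝ) ≤ 1 - 2 * α := by linarith
  rw [leadWeight, leadWeight, ← ENNReal.ofReal_mul (by positivity),
    ← ENNReal.ofReal_mul (by positivity), pow_succ]
  congr 1
  field_simp

theorem tsum_leadWeight (h0 : 0 ≤ α) (h1 : α < 1 / 2) : ∑' l, leadWeight α l = 1 := by
  have hα : (0 : ℝ) < 1 - α := by linarith
  have h2 : (0 : ℝ) ≤ 1 - 2 * α := by linarith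
  have hr : α / (1 - α) < 1 := by rw [div_lt_one hα]; linarith
  have hr0 : 0 ≤ α / (1 - α) := by positivity
  unfold leadWeight
  rw [← ENNReal.ofReal_tsum_of_nonneg (fun l => by positivity)
    ((summable_geometric_of_lt_one hr0 hr).mul_left _), tsum_mul_left,
    tsum_geometric_of_lt_one hr0 hr, ENNReal.ofReal_eq_one]
  have : 1 - α / (1 - α) = (1 - 2 * α) / (1 - α) := by field_simp; ring
  rw [this, mul_inv_cancel₀]
  have : 0 < 1 - 2 * α := by linarith
  positivity

/-- Stationarity, from detailed balance. At the boundary `0 - 1 = 0` keeps the walk in place, which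
accounts for the separate term at 0. -/
theorem tsum_leadWeight_mul_leadStep (h0 : 0 ≤ α) (h1 : α < 1 / 2) (φ : ℕ → ℝ≥0∞) :
    ∑' l, leadWeight α l * leadStep α φ l = ∑' l, leadWeight α l * φ l := by
  set a := ENNReal.ofReal α with ha
  set h := ENNReal.ofReal (1 - α) with hh
  have key : ∀ l, leadWeight α (l + 1) * h = leadWeight α l * a := leadWeight_mul h0 h1
  have e1 : ∑' l, leadWeight α l * leadStep α φ l =
      ∑' l, leadWeight α l * a * φ (l + 1) + ∑' l, leadWeight α l * h * φ (l - 1) := by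
    rw [← ENNReal.tsum_add]
    exact tsum_congr fun l => by rw [leadStep]; ring
  have e2 : ∑' l, leadWeight α l * h * φ (l - 1) =
      leadWeight α 0 * h * φ 0 + ∑' l, leadWeight α l * a * φ l := by
    rw [tsum_eq_zero_add' ENNReal.summable]
    simp [key]
  have e3 : ∑' l, leadWeight α l * h * φ l =
      leadWeight α 0 * h * φ 0 + ∑' l, leadWeight α l * a * φ (l + 1) := by
    rw [tsum_eq_zero_add' ENNReal.summable]
    simp [key]
  have e4 : ∑' l, leadWeight α l * φ l =
      ∑' l, leadWeight α l * h * φ l + ∑' l, leadWeight α l * a * φ l := by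
    rw [← ENNReal.tsum_add]
    refine tsum_congr fun l => ?_
    calc _ = leadWeight α l * (a + h) * φ l := by
          rw [ha, hh, ofReal_add_ofReal_one_sub h0 h1, mul_one]
      _ = _ := by ring
  rw [e1, e2, e4, e3]
  ring

theorem apply_zero_le_tsum_leadWeight_mul (h0 : 0 ≤ α) (h1 : α < 1 / 2) {φ : ℕ → ℝ≥0∞}
    (hφ : Monotone φ) : φ 0 ≤ ∑' l, leadWeight α l * φ l :=
  calc φ 0 = ∑' l, leadWeight α l * φ 0 := by
        rw [ENNReal.tsum_mul_right, tsum_leadWeight h0 h1, one_mul]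
    _ ≤ _ := ENNReal.tsum_le_tsum fun l => by gcongr; exact hφ (Nat.zero_le l)

/-! ### Decay in the number of confirmations -/

/-- The total mass of a negative binomial law with parameter 1/2, up to the factor `2 ^ k`. -/
theorem tsum_choose_mul_half_pow (k : ℕ) :
    ∑' n : ℕ, ((n + k - 1).choose n : ℝ≥0∞) * ENNReal.ofReal (1 / 2) ^ n = 2 ^ k := by
  cases k with
  | zero =>
    rw [tsum_eq_single 0]
    · simp
    · intro n hn
      rw [Nat.choose_eq_zero_of_lt (by omega)]; simp
  | succ j =>
    have hn : ‖(1 / 2 : ℝ)‖ < 1 := by norm_num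
    have hs := hasSum_choose_mul_geometric_of_norm_lt_one j hn
    have e : ∀ n : ℕ, ((n + (j + 1) - 1).choose n : ℝ≥0∞) * ENNReal.ofReal (1 / 2) ^ n =
        ENNReal.ofReal (((n + j).choose j : ℝ) * (1 / 2) ^ n) := by
      intro n
      rw [ENNReal.ofReal_mul (by positivity), ENNReal.ofReal_pow (by norm_num),
        ENNReal.ofReal_natCast, ← Nat.choose_symm_add, show n + (j + 1) - 1 = n + j by omega]
    simp_rw [e]
    rw [← ENNReal.ofReal_tsum_of_nonneg (fun n => by positivity) hs.summable, hs.tsum_eq,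
      show (1 : ℝ) / (1 - 1 / 2) ^ (j + 1) = 2 ^ (j + 1) by
        rw [← one_div_pow]; norm_num,
      ENNReal.ofReal_pow (by norm_num), ENNReal.ofReal_ofNat]

/-- Removes the truncated exponent: the right side is `s ^ (n - m)` if `m ≤ n`, and a power of `b ≥
1` otherwise. -/
theorem pow_sub_le_pow_mul_pow {r s b : ℝ} (hr : 0 ≤ r) (hrs : r ≤ s) (hb : 1 ≤ b)
    (hsb : s * b = 1) (m n : ℕ) : r ^ (n - m) ≤ s ^ n * b ^ m := by
  have hs : 0 ≤ s := hr.trans hrs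
  rcases le_total n m with h | h
  · obtain ⟨e, rfl⟩ := Nat.exists_eq_add_of_le h
    rw [Nat.sub_eq_zero_of_le h, pow_zero, pow_add, ← mul_assoc, ← mul_pow, hsb, one_pow, one_mul]
    exact one_le_pow₀ hb
  · obtain ⟨e, rfl⟩ := Nat.exists_eq_add_of_le h
    rw [Nat.add_sub_cancel_left, pow_add, mul_right_comm, ← mul_pow, hsb, one_pow, one_mul]
    gcongr

/-- The base s = 1/(2(1-α)) dominates α/(1-α) because α < 1/2, and it makes (1-α)s = 1/2, so that
the negative binomial series sums to 2^k. -/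
theorem successProb_le (h0 : 0 ≤ α) (h1 : α < 1 / 2) (k l : ℕ) :
    successProb α k l ≤
      ENNReal.ofReal (4 * α * (1 - α)) ^ k * ENNReal.ofReal (2 * (1 - α)) ^ l := by
  have hα : (0 : ℝ) < 1 - α := by linarith
  have hq : ∀ n : ℕ, catchUpProb α (l + k - n) ≤
      ENNReal.ofReal (1 / (2 * (1 - α))) ^ n * ENNReal.ofReal (2 * (1 - α)) ^ (k + l) := by
    intro n
    rw [catchUpProb, show (-((l : ℤ) + k - n)).toNat = n - (k + l) by omega,
      ← ENNReal.ofReal_pow (by positivity), ← ENNReal.ofReal_pow (by positivity),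
      ← ENNReal.ofReal_pow (by positivity), ← ENNReal.ofReal_mul (by positivity)]
    refine ENNReal.ofReal_le_ofReal (pow_sub_le_pow_mul_pow (by positivity) ?_ (by linarith) ?_ _ _)
    · rw [div_le_div_iff₀ hα (by positivity)]; nlinarith
    · field_simp
  have hhalf : ENNReal.ofReal (1 - α) * ENNReal.ofReal (1 / (2 * (1 - α))) =
      ENNReal.ofReal (1 / 2) := by
    rw [← ENNReal.ofReal_mul hα.le]; congr 1; field_simp
  have hprod : ENNReal.ofReal α * ENNReal.ofReal (2 * (1 - α)) * 2 =
      ENNReal.ofReal (4 * α * (1 - α)) := by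
    rw [← ENNReal.ofReal_mul h0, ← ENNReal.ofReal_ofNat 2, ← ENNReal.ofReal_mul (by positivity)]
    congr 1; norm_num; ring
  calc successProb α k l
      ≤ ∑' n : ℕ, ((n + k - 1).choose n : ℝ≥0∞) * ENNReal.ofReal α ^ k *
          ENNReal.ofReal (1 - α) ^ n * (ENNReal.ofReal (1 / (2 * (1 - α))) ^ n *
            ENNReal.ofReal (2 * (1 - α)) ^ (k + l)) :=
        ENNReal.tsum_le_tsum fun n => by gcongr; exact hq n
    _ = ∑' n : ℕ, (ENNReal.ofReal α ^ k * ENNReal.ofReal (2 * (1 - α)) ^ (k + l)) *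
          (((n + k - 1).choose n : ℝ≥0∞) * ENNReal.ofReal (1 / 2) ^ n) :=
        tsum_congr fun n => by rw [← hhalf, mul_pow]; ring
    _ = _ := by
        rw [ENNReal.tsum_mul_left, tsum_choose_mul_half_pow, ← hprod, mul_pow, mul_pow]; ring

/-- The growth (2(1-α))^l in the lead is absorbed by the geometric weight, leaving a convergent
series of ratio 2α. -/
theorem exists_g_le (h0 : 0 ≤ α) (h1 : α < 1 / 2) :
    ∃ C : ℝ≥0∞, C ≠ ∞ ∧ ∀ k, g k α ≤ C * ENNReal.ofReal (4 * α * (1 - α)) ^ k := by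
  have hα : (0 : ℝ) < 1 - α := by linarith
  have h2 : (0 : ℝ) ≤ 1 - 2 * α := by linarith
  refine ⟨∑' l : ℕ, ENNReal.ofReal ((1 - 2 * α) / (1 - α)) * ENNReal.ofReal (2 * α) ^ l, ?_,
    fun k => ?_⟩
  · rw [ENNReal.tsum_mul_left, ENNReal.tsum_geometric]
    refine ENNReal.mul_ne_top ENNReal.ofReal_ne_top (ENNReal.inv_ne_top.mpr ?_)
    rw [← ENNReal.ofReal_one, ← ENNReal.ofReal_sub _ (by positivity)]
    simp; linarith
  · rw [g_eq_tsum_leadWeight h0 h1, ← ENNReal.tsum_mul_right]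
    refine ENNReal.tsum_le_tsum fun l => ?_
    refine (mul_le_mul_right (successProb_le h0 h1 k l) _).trans_eq ?_
    have : leadWeight α l * ENNReal.ofReal (2 * (1 - α)) ^ l =
        ENNReal.ofReal ((1 - 2 * α) / (1 - α)) * ENNReal.ofReal (2 * α) ^ l := by
      rw [leadWeight, ← ENNReal.ofReal_pow (by positivity), ← ENNReal.ofReal_pow (by positivity),
        ← ENNReal.ofReal_mul (by positivity), ← ENNReal.ofReal_mul (by positivity), mul_assoc,
        ← mul_pow]
      congr 3
      field_simp
    rw [← this]; ring

theorem sufficientConfirmations_nonempty (h0 : 0 ≤ α) (h1 : α < 1 / 2) {ε : ℝ} (hε : 0 < ε) :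
    (sufficientConfirmations ε α).Nonempty := by
  obtain ⟨C, hC, hg⟩ := exists_g_le h0 h1
  have hq : ENNReal.ofReal (4 * α * (1 - α)) < 1 := by
    rw [ENNReal.ofReal_lt_one]; nlinarith [sq_nonneg (1 - 2 * α)]
  have ht : Tendsto (fun k => C * ENNReal.ofReal (4 * α * (1 - α)) ^ k) atTop (nhds 0) := by
    simpa using ENNReal.Tendsto.const_mul (ENNReal.tendsto_pow_atTop_nhds_zero_of_lt_one hq)
      (.inr hC)
  have hpos : 0 < ENNReal.ofReal (ε * (1 - α)) :=
    ENNReal.ofReal_pos.mpr (mul_pos hε (by linarith))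
  obtain ⟨k, hk⟩ := (ht.eventually_lt_const hpos).exists
  exact ⟨k, (hg k).trans_lt hk⟩

theorem g_ne_top (h0 : 0 ≤ α) (h1 : α < 1 / 2) (k : ℕ) : g k α ≠ ∞ := by
  obtain ⟨C, hC, hg⟩ := exists_g_le h0 h1
  exact ne_top_of_le_ne_top (ENNReal.mul_ne_top hC (ENNReal.pow_ne_top ENNReal.ofReal_ne_top)) (hg k)

end

/-! ### Independent coins -/

/-- The law of the sequence of the creators of the blocks. -/
noncomputable def coinLaw (α : unitInterval) : Measure (ℕ → Bool) :=
  Measure.infinitePi fun _ : ℕ => bernoulliMeasure true false α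

instance (α : unitInterval) : IsProbabilityMeasure (coinLaw α) := by
  unfold coinLaw; infer_instance

theorem lintegral_bernoulliMeasure_bool (α : unitInterval) (f : Bool → ℝ≥0∞) :
    ∫⁻ b, f b ∂(bernoulliMeasure true false α) =
      ENNReal.ofReal α * f true + ENNReal.ofReal (1 - α) * f false := by
  have e1 : ((unitInterval.toNNReal α : NNReal) : ℝ≥0∞) = ENNReal.ofReal α := by
    rw [ENNReal.ofReal, Real.toNNReal_of_nonneg α.2.1]; rfl
  have e2 : ((unitInterval.toNNReal (unitInterval.symm α) : NNReal) : ℝ≥0∞) =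
      ENNReal.ofReal (1 - α) := by
    rw [ENNReal.ofReal, Real.toNNReal_of_nonneg (sub_nonneg.mpr α.2.2)]; rfl
  rw [bernoulliMeasure_def, lintegral_add_measure, lintegral_smul_measure, lintegral_smul_measure,
    lintegral_dirac, lintegral_dirac, ENNReal.smul_def, ENNReal.smul_def, e1, e2]
  simp

/-- Coin `n` is independent of the coins before it, so it can be integrated out; this replaces
conditional expectations throughout. -/
theorem lintegral_coinLaw_ite (α : unitInterval) {n : ℕ} {F G : (ℕ → Bool) → ℝ≥0∞}
    (hF : ∀ x y, (∀ i < n, x i = y i) → F x = F y)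
    (hG : ∀ x y, (∀ i < n, x i = y i) → G x = G y) :
    ∫⁻ x, (if x n then F x else G x) ∂(coinLaw α) =
      ∫⁻ x, (ENNReal.ofReal α * F x + ENNReal.ofReal (1 - α) * G x) ∂(coinLaw α) := by
  let R : (ℕ → Bool) → (Finset.range n → Bool) := fun x i => x i
  -- Padding with `false` makes `F` and `G` functions on a finite discrete space, where
  -- measurability is automatic.
  let ext : (Finset.range n → Bool) → (ℕ → Bool) :=
    fun y i => if h : i ∈ Finset.range n then y ⟨i, h⟩ else false
  have hext : ∀ x, ∀ i < n, x i = ext (R x) i := by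
    intro x i hi
    simp only [ext, R]
    rw [dif_pos (Finset.mem_range.mpr hi)]
  have hR : Measurable R := by fun_prop
  have hX : Measurable fun x : ℕ → Bool => x n := measurable_pi_apply n
  have hind : IndepFun R (fun x : ℕ → Bool => x n) (coinLaw α) := by
    have hi : iIndepFun (fun (i : ℕ) (x : ℕ → Bool) => x i) (coinLaw α) :=
      iIndepFun_infinitePi (P := fun _ : ℕ => bernoulliMeasure true false α)
        (X := fun _ b => b) (fun _ => measurable_id)
    have := hi.indepFun_finset (Finset.range n) {n} (by simp) (fun i => measurable_pi_apply i)
    exact this.comp (ψ := fun y : ((({n} : Finset ℕ) : Type) → Bool) => y ⟨n, by simp⟩)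
      measurable_id (measurable_pi_apply _)
  have hmap : (coinLaw α).map (fun x => x n) = bernoulliMeasure true false α :=
    Measure.infinitePi_map_eval _ n
  let H : (Finset.range n → Bool) × Bool → ℝ≥0∞ :=
    fun p => if p.2 then F (ext p.1) else G (ext p.1)
  have hH : Measurable H := Measurable.of_discrete
  have hpair := (indepFun_iff_map_prod_eq_prod_map_map hR.aemeasurable hX.aemeasurable).mp hind
  calc ∫⁻ x, (if x n then F x else G x) ∂(coinLaw α)
      = ∫⁻ x, H (R x, x n) ∂(coinLaw α) := by
        refine lintegral_congr fun x => ?_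
        simp only [H]
        rw [hF x _ (hext x), hG x _ (hext x)]
    _ = ∫⁻ p, H p ∂((coinLaw α).map fun x => (R x, x n)) :=
        (lintegral_map hH (hR.prodMk hX)).symm
    _ = ∫⁻ y, ∫⁻ b, H (y, b) ∂(bernoulliMeasure true false α) ∂((coinLaw α).map R) := by
        rw [hpair, hmap, lintegral_prod _ hH.aemeasurable]
    _ = ∫⁻ x, ∫⁻ b, H (R x, b) ∂(bernoulliMeasure true false α) ∂(coinLaw α) :=
        lintegral_map Measurable.of_discrete hR
    _ = _ := by
        refine lintegral_congr fun x => ?_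
        rw [lintegral_bernoulliMeasure_bool, hF x _ (hext x), hG x _ (hext x)]
        simp [H]

theorem measurable_byAttacker : Measurable Draw.byAttacker := measurable_fst.comp measurable_snd

theorem isProbabilityMeasure_drawLaw {lam : ℝ} (α γ : unitInterval) (hlam : 0 < lam) : IsProbabilityMeasure (drawLaw lam α γ) := by
  have := isProbabilityMeasure_expMeasure hlam
  unfold drawLaw; infer_instance

theorem map_byAttacker_drawLaw {lam : ℝ} (α γ : unitInterval) (hlam : 0 < lam) :
    (drawLaw lam α γ).map Draw.byAttacker = bernoulliMeasure true false α := by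
  have := isProbabilityMeasure_expMeasure hlam
  change Measure.map (Prod.fst ∘ Prod.snd) _ = _
  rw [← Measure.map_map measurable_fst measurable_snd, drawLaw, Measure.map_snd_prod,
    measure_univ, one_smul, Measure.map_fst_prod, measure_univ, one_smul]

theorem map_attackerBits_miningLaw {lam : ℝ} (hlam : 0 < lam) (α γ : unitInterval) :
    (miningLaw lam α γ).map attackerBits = coinLaw α := by
  have := isProbabilityMeasure_drawLaw α γ hlam
  refine (Measure.infinitePi_map_pi (fun _ : ℕ => drawLaw lam α γ)
    (f := fun _ => Draw.byAttacker) fun _ => measurable_byAttacker).trans ?_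
  simp_rw [map_byAttacker_drawLaw α γ hlam]
  rfl

/-! ### The random walks -/

theorem leadWalk_congr {x y : ℕ → Bool} {n : ℕ} (h : ∀ i < n, x i = y i) :
    leadWalk x n = leadWalk y n := by
  induction n with
  | zero => rfl
  | succ n ih =>
    rw [leadWalk, leadWalk, h n n.lt_succ_self, ih fun i hi => h i (by omega)]

theorem attackerCount_congr {x y : ℕ → Bool} {n : ℕ} (h : ∀ i < n, x i = y i) (m : ℕ) :
    attackerCount x m n = attackerCount y m n := by
  unfold attackerCount
  rw [Finset.filter_congr fun i hi => by rw [h i (Finset.mem_Ico.mp hi).2]]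

theorem honestCount_congr {x y : ℕ → Bool} {n : ℕ} (h : ∀ i < n, x i = y i) (m : ℕ) :
    honestCount x m n = honestCount y m n := by
  unfold honestCount
  rw [Finset.filter_congr fun i hi => by rw [h i (Finset.mem_Ico.mp hi).2]]

theorem catchesUp_congr {x y : ℕ → Bool} {m n : ℕ} (hmn : m ≤ n) (h : ∀ i < n, x i = y i) (k : ℕ) :
    CatchesUp k m x n ↔ CatchesUp k m y n := by
  unfold CatchesUp
  rw [attackerCount_congr h, honestCount_congr h, leadWalk_congr fun i hi => h i (by omega)]

variable {α : unitInterval}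

/-- The walk starts at the least state, and its transition operator preserves both monotonicity and
the stationary mean. The induction therefore passes from `φ` to `leadStep α φ`. -/
theorem lintegral_leadWalk_le (h1 : (α : ℝ) < 1 / 2) (m : ℕ) {φ : ℕ → ℝ≥0∞} (hφ : Monotone φ) :
    ∫⁻ x, φ (leadWalk x m) ∂(coinLaw α) ≤ ∑' l, leadWeight α l * φ l := by
  induction m generalizing φ with
  | zero =>
    simp only [leadWalk, lintegral_const, measure_univ, mul_one]
    exact apply_zero_le_tsum_leadWeight_mul α.2.1 h1 hφ
  | succ m ih =>
    have e : ∀ x : ℕ → Bool, φ (leadWalk x (m + 1)) =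
        if x m then φ (leadWalk x m + 1) else φ (leadWalk x m - 1) := by
      intro x
      rw [leadWalk]; split_ifs <;> rfl
    simp_rw [e]
    rw [lintegral_coinLaw_ite α (F := fun x => φ (leadWalk x m + 1))
      (G := fun x => φ (leadWalk x m - 1))
      (fun x y h => by rw [leadWalk_congr h]) (fun x y h => by rw [leadWalk_congr h])]
    exact (ih (leadStep_mono hφ)).trans_eq (tsum_leadWeight_mul_leadStep α.2.1 h1 φ)

/-- The event that the attacker has caught up at some time between the blocks `m` and `n`. -/
def CaughtUp (k m n : ℕ) (x : ℕ → Bool) : Prop := ∃ i, m ≤ i ∧ i ≤ n ∧ CatchesUp k m x i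

theorem caughtUp_congr {x y : ℕ → Bool} {m n : ℕ} (h : ∀ i < n, x i = y i) (k : ℕ) :
    CaughtUp k m n x ↔ CaughtUp k m n y := by
  unfold CaughtUp
  refine exists_congr fun i => and_congr_right fun hm => and_congr_right fun hn => ?_
  exact catchesUp_congr hm (fun l hl => h l (by omega)) k

/-- The success probability given the state of the attack when block `n` exists. -/
noncomputable def stateProb (α : ℝ) (k m n : ℕ) (x : ℕ → Bool) : ℝ≥0∞ :=
  successProb α (k - attackerCount x m n)
    ((leadWalk x m : ℤ) + attackerCount x m n - honestCount x m n)

theorem one_le_stateProb {x : ℕ → Bool} {k m n : ℕ} (h : CatchesUp k m x n) :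
    1 ≤ stateProb α k m n x := by
  rw [stateProb, Nat.sub_eq_zero_of_le h.1]
  have := h.2
  exact one_le_successProb_zero (by omega)

open Classical in
/-- The conditional probability, when block `n` exists, of catching up after block `m`. -/
noncomputable def attackValue (α : ℝ) (k m n : ℕ) (x : ℕ → Bool) : ℝ≥0∞ :=
  if CaughtUp k m n x then 1 else stateProb α k m n x

theorem attackValue_succ_le {x : ℕ → Bool} {k m n : ℕ} (hx : ¬CaughtUp k m n x) :
    attackValue α k m (n + 1) x ≤ stateProb α k m (n + 1) x := by
  rw [attackValue]
  split_ifs with h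
  · obtain ⟨i, hi, hi', hc⟩ := h
    rcases Nat.of_le_succ hi' with hi' | rfl
    · exact absurd ⟨i, hi, hi', hc⟩ hx
    · exact one_le_stateProb hc
  · exact le_rfl

/-- The supermartingale step: `F` and `G` bound the next value according to the creator of block `n
+ 1`, and harmonicity averages them back to the present value. -/
theorem lintegral_attackValue_succ_le (h1 : (α : ℝ) < 1 / 2) {k m n : ℕ} (hmn : m ≤ n) :
    ∫⁻ x, attackValue α k m (n + 1) x ∂(coinLaw α) ≤ ∫⁻ x, attackValue α k m n x ∂(coinLaw α) := by
  classical
  let F : (ℕ → Bool) → ℝ≥0∞ := fun x => if CaughtUp k m n x then 1 else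
    successProb α (k - attackerCount x m n - 1)
      ((leadWalk x m : ℤ) + attackerCount x m n - honestCount x m n + 1)
  let G : (ℕ → Bool) → ℝ≥0∞ := fun x => if CaughtUp k m n x then 1 else
    successProb α (k - attackerCount x m n)
      ((leadWalk x m : ℤ) + attackerCount x m n - honestCount x m n - 1)
  have hF : ∀ x y, (∀ i < n, x i = y i) → F x = F y := by
    intro x y h
    simp only [F, caughtUp_congr h, attackerCount_congr h, honestCount_congr h,
      leadWalk_congr fun i (hi : i < m) => h i (by omega)]
  have hG : ∀ x y, (∀ i < n, x i = y i) → G x = G y := by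
    intro x y h
    simp only [G, caughtUp_congr h, attackerCount_congr h, honestCount_congr h,
      leadWalk_congr fun i (hi : i < m) => h i (by omega)]
  calc ∫⁻ x, attackValue α k m (n + 1) x ∂(coinLaw α)
      ≤ ∫⁻ x, (if x n then F x else G x) ∂(coinLaw α) := by
        refine lintegral_mono fun x => ?_
        by_cases hx : CaughtUp k m n x
        · have hx' : CaughtUp k m (n + 1) x := by
            obtain ⟨i, hi, hi', hc⟩ := hx
            exact ⟨i, hi, by omega, hc⟩
          simp [attackValue, F, G, hx, hx']
        · refine (attackValue_succ_le hx).trans_eq ?_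
          simp only [F, G, if_neg hx, stateProb, attackerCount_succ x hmn, honestCount_succ x hmn]
          split_ifs
          · congr 1
            push_cast; ring
          · congr 1
            push_cast; ring
    _ = _ := lintegral_coinLaw_ite α hF hG
    _ ≤ _ := by
        refine lintegral_mono fun x => ?_
        simp only [F, G, attackValue]
        split_ifs with hx
        · simp [ofReal_add_ofReal_one_sub α.2.1 h1]
        · refine (successProb_step α.2.1 h1 ?_).le
          rintro ⟨h, h'⟩
          exact hx ⟨n, hmn, le_rfl, by omega, by omega⟩

theorem lintegral_attackValue_le (h1 : (α : ℝ) < 1 / 2) {k m n : ℕ} (hmn : m ≤ n) :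
    ∫⁻ x, attackValue α k m n x ∂(coinLaw α) ≤ g k α := by
  induction n, hmn using Nat.le_induction with
  | base =>
    rw [g_eq_tsum_leadWeight α.2.1 h1]
    refine le_trans (lintegral_mono fun x => ?_)
      (lintegral_leadWalk_le h1 m (φ := fun l => successProb α k l)
        fun a b h => successProb_mono h1 k (by exact_mod_cast h))
    have e : stateProb α k m m x = successProb α k (leadWalk x m) := by
      simp [stateProb, attackerCount_self, honestCount_self]
    rw [attackValue]
    split_ifs with h
    · obtain ⟨i, hi, hi', hc⟩ := h
      obtain rfl : m = i := le_antisymm hi hi'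
      exact (one_le_stateProb hc).trans_eq e
    · exact e.le
  | succ n hmn ih => exact (lintegral_attackValue_succ_le h1 hmn).trans ih

/-- The event is decided by the first `n` coins, so it is the preimage of a subset of a finite
space. -/
theorem measurableSet_caughtUp (k m n : ℕ) : MeasurableSet {x | CaughtUp k m n x} := by
  have : {x : ℕ → Bool | CaughtUp k m n x} =
      (fun (x : ℕ → Bool) (i : Finset.range n) => x i) ⁻¹'
        ((fun (x : ℕ → Bool) (i : Finset.range n) => x i) '' {x | CaughtUp k m n x}) := by
    refine Set.Subset.antisymm (Set.subset_preimage_image _ _) ?_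
    rintro x ⟨y, hy, hxy⟩
    refine (caughtUp_congr (fun i hi => ?_) k).mp hy
    exact congrFun hxy ⟨i, Finset.mem_range.mpr hi⟩
  rw [this]
  exact (by fun_prop : Measurable fun (x : ℕ → Bool) (i : Finset.range n) => x i)
    (Set.toFinite _).measurableSet

theorem coinLaw_caughtUp_le (h1 : (α : ℝ) < 1 / 2) {k m n : ℕ} (hmn : m ≤ n) :
    coinLaw α {x | CaughtUp k m n x} ≤ g k α := by
  classical
  rw [← lintegral_indicator_one (measurableSet_caughtUp k m n)]
  refine (lintegral_mono fun x => ?_).trans (lintegral_attackValue_le h1 hmn)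
  by_cases hx : CaughtUp k m n x <;> simp [attackValue, hx]

/-- Every block is double spent with probability at most `g k α`. -/
theorem miningLaw_attacked_le {lam : ℝ} (hlam : 0 < lam) (h1 : (α : ℝ) < 1 / 2) (γ : unitInterval)
    (k : ℕ) (π : AttackPolicy) (m : ℕ) :
    miningLaw lam α γ (attacked (fun _ => k) π (m + 1)) ≤ g k α := by
  have hsub : attacked (fun _ => k) π (m + 1) ⊆
      attackerBits ⁻¹' (⋃ n : ℕ, {x | CaughtUp k m (m + n) x}) := by
    intro ω hω
    obtain ⟨n, hmn, hc⟩ := exists_catchesUp_of_mem_attacked π ω hω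
    exact Set.mem_iUnion.mpr ⟨n - m, n, hmn, by omega, hc⟩
  have hbits : Measurable attackerBits :=
    measurable_pi_lambda _ fun i => measurable_byAttacker.comp (measurable_pi_apply i)
  refine (measure_mono hsub).trans ?_
  rw [← Measure.map_apply hbits (.iUnion fun n => measurableSet_caughtUp k m (m + n)),
    map_attackerBits_miningLaw hlam, Monotone.measure_iUnion]
  · exact iSup_le fun n => coinLaw_caughtUp_le h1 (Nat.le_add_right m n)
  · rintro a b hab x ⟨i, hi, hi', hc⟩
    exact ⟨i, hi, by omega, hc⟩

/-! ### Long-run frequencies -/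

section

variable {lam : ℝ} (α γ : unitInterval)

theorem map_gap_drawLaw : (drawLaw lam α γ).map Draw.gap = expMeasure lam := by
  change Measure.map Prod.fst _ = _
  rw [drawLaw, Measure.map_fst_prod, measure_univ, one_smul]

theorem measurable_gap : Measurable Draw.gap := measurable_fst

theorem map_eval_miningLaw (hlam : 0 < lam) (i : ℕ) :
    (miningLaw lam α γ).map (fun ω => ω i) = drawLaw lam α γ := by
  have := isProbabilityMeasure_drawLaw α γ hlam
  exact Measure.infinitePi_map_eval _ i

theorem tendsto_frequency (hlam : 0 < lam) {S : Set Draw} (hS : MeasurableSet S) :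
    ∀ᵐ ω ∂(miningLaw lam α γ),
      Tendsto (fun n : ℕ => (∑ i ∈ Finset.range n, S.indicator (fun _ => (1 : ℝ)) (ω i)) / n) atTop
        (nhds ((drawLaw lam α γ).real S)) := by
  have := isProbabilityMeasure_drawLaw α γ hlam
  have : IsProbabilityMeasure (miningLaw lam α γ) := by unfold miningLaw; infer_instance
  have hf : Measurable (S.indicator fun _ => (1 : ℝ)) := measurable_const.indicator hS
  have hind : iIndepFun (fun (i : ℕ) (ω : ℕ → Draw) => S.indicator (fun _ => (1 : ℝ)) (ω i))
      (miningLaw lam α γ) :=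
    iIndepFun_infinitePi (P := fun _ : ℕ => drawLaw lam α γ) (fun _ => hf)
  have hint : Integrable (fun ω : ℕ → Draw => S.indicator (fun _ => (1 : ℝ)) (ω 0))
      (miningLaw lam α γ) :=
    .of_bound (hf.comp (measurable_pi_apply 0)).aestronglyMeasurable 1
      (.of_forall fun ω => (norm_indicator_le_norm_self _ _).trans (by simp))
  have hident : ∀ i, IdentDistrib (fun ω : ℕ → Draw => S.indicator (fun _ => (1 : ℝ)) (ω i))
      (fun ω : ℕ → Draw => S.indicator (fun _ => (1 : ℝ)) (ω 0))
      (miningLaw lam α γ) (miningLaw lam α γ) := fun i =>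
    IdentDistrib.comp ⟨(measurable_pi_apply i).aemeasurable, (measurable_pi_apply 0).aemeasurable,
      (map_eval_miningLaw α γ hlam i).trans (map_eval_miningLaw α γ hlam 0).symm⟩ hf
  have hmean : ∫ ω, S.indicator (fun _ => (1 : ℝ)) (ω 0) ∂(miningLaw lam α γ) =
      (drawLaw lam α γ).real S := by
    rw [← map_eval_miningLaw α γ hlam 0,
      ← integral_indicator_one (μ := (miningLaw lam α γ).map fun ω => ω 0) hS]
    exact (integral_map (measurable_pi_apply 0).aemeasurable hf.aestronglyMeasurable).symm
  have := strong_law_ae_real _ hint (fun i j hij => hind.indepFun hij) hident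
  rwa [hmean] at this

theorem tendsto_honestCount_div (hlam : 0 < lam) :
    ∀ᵐ ω ∂(miningLaw lam α γ),
      Tendsto (fun n : ℕ => (honestCount (attackerBits ω) 0 n : ℝ) / n) atTop
        (nhds (1 - (α : ℝ))) := by
  have hS : MeasurableSet (Draw.byAttacker ⁻¹' {false}) :=
    measurable_byAttacker (measurableSet_singleton _)
  have hp : (drawLaw lam α γ).real (Draw.byAttacker ⁻¹' {false}) = 1 - (α : ℝ) := by
    rw [← map_measureReal_apply measurable_byAttacker (measurableSet_singleton _),
      map_byAttacker_drawLaw α γ hlam]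
    simp
  filter_upwards [tendsto_frequency α γ hlam hS] with ω hω
  rw [hp] at hω
  refine hω.congr fun n => ?_
  congr 1
  rw [honestCount, Finset.card_filter, Nat.cast_sum, Finset.range_eq_Ico]
  refine Finset.sum_congr rfl fun i _ => ?_
  classical
  have h : ω i ∈ Draw.byAttacker ⁻¹' {false} ↔ attackerBits ω i = false := Iff.rfl
  rw [Set.indicator_apply, if_congr h rfl rfl, Nat.cast_ite, Nat.cast_one, Nat.cast_zero]

theorem ae_gap_pos (hlam : 0 < lam) : ∀ᵐ ω ∂(miningLaw lam α γ), ∀ i, 0 < (ω i).gap := by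
  have := isProbabilityMeasure_expMeasure hlam
  rw [ae_all_iff]
  intro i
  have h0 : ∀ᵐ x ∂(expMeasure lam), 0 < x := by
    have h := cdf_expMeasure_eq hlam 0
    rw [cdf_eq_real] at h
    rw [ae_iff]
    simpa [measureReal_eq_zero_iff, Set.Iic_def] using h
  rw [← map_gap_drawLaw α γ, ← map_eval_miningLaw α γ hlam i] at h0
  exact ae_of_ae_map (measurable_pi_apply i).aemeasurable
    (ae_of_ae_map measurable_gap.aemeasurable h0)

theorem drawLaw_one_lt_gap_pos (hlam : 0 < lam) :
    0 < (drawLaw lam α γ).real (Draw.gap ⁻¹' Set.Ioi 1) := by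
  have := isProbabilityMeasure_expMeasure hlam
  rw [← map_measureReal_apply measurable_gap measurableSet_Ioi, map_gap_drawLaw, ← Set.compl_Iic,
    measureReal_compl measurableSet_Iic, ← cdf_eq_real, cdf_expMeasure_eq hlam]
  simp [Real.exp_pos]

/-- Gaps longer than 1 occur with positive frequency, and their number bounds the creation time from
below. Only the law of large numbers for indicators is needed. -/
theorem tendsto_creationTime (hlam : 0 < lam) :
    ∀ᵐ ω ∂(miningLaw lam α γ), Tendsto (creationTime ω) atTop atTop := by
  filter_upwards [ae_gap_pos α γ hlam,
    tendsto_frequency α γ hlam (measurable_gap measurableSet_Ioi)] with ω hpos hω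
  have h1 := (hω.pos_mul_atTop (drawLaw_one_lt_gap_pos α γ hlam)
    tendsto_natCast_atTop_atTop).comp (tendsto_add_atTop_nat 1)
  refine tendsto_atTop_mono (fun n => ?_) h1
  simp only [Function.comp_apply]
  rw [div_mul_cancel₀ _ (by positivity), creationTime]
  classical
  refine Finset.sum_le_sum fun i _ => ?_
  rw [Set.indicator_apply]
  split_ifs with h
  · exact le_of_lt h
  · exact (hpos i).le

theorem tendsto_numBlocks {ω : ℕ → Draw} (h : Tendsto (creationTime ω) atTop atTop) :
    Tendsto (numBlocks ω) atTop atTop := by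
  refine tendsto_atTop.mpr fun M => ?_
  -- `ncard` is 0 on infinite sets, so the lower bound on `numBlocks` requires finiteness.
  have hfin : ∀ t : ℝ, {n : ℕ | creationTime ω n ≤ t}.Finite := by
    intro t
    obtain ⟨N, hN⟩ := eventually_atTop.mp (h.eventually_gt_atTop t)
    refine (Set.finite_lt_nat N).subset fun n hn => ?_
    by_contra hc
    exact absurd (hN n (not_lt.mp hc)) (not_lt.mpr hn)
  have hev : ∀ᶠ t : ℝ in atTop, ∀ n ∈ Finset.range M, creationTime ω n ≤ t :=
    (Finset.eventually_all _).mpr fun n _ => eventually_ge_atTop _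
  filter_upwards [hev] with t ht
  calc M = (↑(Finset.range M) : Set ℕ).ncard := by rw [Set.ncard_coe_finset, Finset.card_range]
    _ ≤ _ := Set.ncard_le_ncard (fun n hn => ht n hn) (hfin t)

end

/-! ### The attacked fraction -/

/-- Genesis contributes nothing, so the fraction is at most n·p/H = p/(H/n), where H is the honest
count among n blocks. -/
theorem limsup_attackedFraction_le {lam : ℝ} {α γ : unitInterval} {σ : ℕ → ℕ} {π : AttackPolicy}
    {ω : ℕ → Draw} {p : ℝ≥0∞} (hα : (α : ℝ) < 1)
    (hp : ∀ m, miningLaw lam α γ (attacked σ π (m + 1)) ≤ p) (hp' : p ≠ ∞)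
    (hN : Tendsto (numBlocks ω) atTop atTop)
    (hH : Tendsto (fun n : ℕ => (honestCount (attackerBits ω) 0 n : ℝ) / n) atTop
        (nhds (1 - (α : ℝ)))) :
    limsup (fun t : ℝ => attackedFraction lam α γ σ π ω t) atTop ≤ p / ENNReal.ofReal (1 - α) := by
  have hlim : Tendsto (fun n : ℕ => p / ENNReal.ofReal
      ((honestCount (attackerBits ω) 0 n : ℝ) / n)) atTop (nhds (p / ENNReal.ofReal (1 - α))) :=
    ENNReal.Tendsto.div tendsto_const_nhds
      (.inr (by simpa using hα)) (ENNReal.tendsto_ofReal hH) (.inr hp')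
  refine le_trans (limsup_le_limsup ?_) (hlim.comp hN).limsup_eq.le
  filter_upwards [hN.eventually_ge_atTop 1] with t ht
  set n := numBlocks ω t with hn
  have hn0 : (0 : ℝ) < n := by exact_mod_cast ht
  have hsum : ∑ b ∈ Finset.range (n + 1), miningLaw lam α γ (attacked σ π b) ≤ n * p := by
    rw [Finset.sum_range_succ', attacked_zero, measure_empty, add_zero]
    refine (Finset.sum_le_sum fun m _ => hp m).trans ?_
    simp
  simp only [attackedFraction, Function.comp_apply]
  rw [← hn, height_honestTip, ENNReal.ofReal_div_of_pos hn0, ENNReal.ofReal_natCast,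
    ENNReal.ofReal_natCast]
  refine (ENNReal.div_le_div_right hsum _).trans_eq ?_
  have hn1 : (n : ℝ≥0∞) ≠ 0 := by exact_mod_cast (by omega : n ≠ 0)
  rw [div_eq_mul_inv p, ENNReal.inv_div (.inl (ENNReal.natCast_ne_top _)) (.inl hn1),
    div_eq_mul_inv, div_eq_mul_inv]
  ring

theorem ae_limsup_attackedFraction_le {lam : ℝ} (hlam : 0 < lam) {α : unitInterval}
    (hα : (α : ℝ) < 1 / 2) (γ : unitInterval) (k : ℕ) (π : AttackPolicy) :
    ∀ᵐ ω ∂(miningLaw lam α γ),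
      limsup (fun t : ℝ => attackedFraction lam α γ (fun _ => k) π ω t) atTop ≤
        g k α / ENNReal.ofReal (1 - α) := by
  filter_upwards [tendsto_creationTime α γ hlam, tendsto_honestCount_div α γ hlam] with ω h1 h2
  exact limsup_attackedFraction_le (by linarith) (miningLaw_attacked_le hlam hα γ k π)
    (g_ne_top α.2.1 hα k) (tendsto_numBlocks h1) h2

end Vector76

theorem mainTheorem3 (lam : ℝ) (hlam : 0 < lam) (α : unitInterval) (hα : (α : ℝ) < 1 / 2)
    (γ : unitInterval) :
    (∀ ε : ℝ, 0 < ε →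
      (∀ h : ℕ, IsLeast (Vector76.sufficientConfirmations ε α) (Vector76.sigmaSpv ε α h)) ∧
        Vector76.IsFractionalRobust lam α γ (Vector76.sigmaSpv ε α) ε) ∧
    ∀ (k : ℕ) (π : Vector76.AttackPolicy), ∀ᵐ ω ∂(Vector76.miningLaw lam α γ),
      Filter.limsup
          (fun t : ℝ => Vector76.attackedFraction lam α γ (fun _ => k) π ω t) Filter.atTop ≤
        Vector76.g k α / ENNReal.ofReal (1 - α) := by
  refine ⟨fun ε hε => ?_, Vector76.ae_limsup_attackedFraction_le hlam hα γ⟩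
  have hmem := Nat.sInf_mem (Vector76.sufficientConfirmations_nonempty α.2.1 hα hε)
  refine ⟨fun _ => ⟨hmem, fun k hk => Nat.sInf_le hk⟩, fun π => ?_⟩
  filter_upwards [Vector76.ae_limsup_attackedFraction_le hlam hα γ
    (sInf (Vector76.sufficientConfirmations ε α)) π] with ω hω
  have hα' : (0 : ℝ) < 1 - α := by linarith
  refine lt_of_le_of_lt hω ((ENNReal.div_lt_iff (.inl (by simpa using hα'))
    (.inl ENNReal.ofReal_ne_top)).mpr ?_)
  rw [← ENNReal.ofReal_mul hε.le]
  exact hmem
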